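/- Let $n\ge 1$, let $\Phi\subset\mathbb R^n$ be a finite reduced root system (not necessarily crystallographic) with simple roots $\alpha_1,\dots,\alpha_n$ forming a basis of $\mathbb R^n$: every root is a linear combination of the $\alpha_i$ whose coefficients are all $\ge 0$ or all $\le 0$. Let $W$ be the finite Coxeter group generated by the reflections $r_i x = x-\frac{2\langle\alpha_i,x\rangle}{\langle\alpha_i,\alpha_i\rangle}\alpha_i$, $i=1,\dots,n$. The nodes of its Coxeter–Dynkin diagram are the simple roots, and two distinct nodes are linked exactly when the roots are not orthogonal. Assume: (i) the diagram (with labels and multiplicities of links disregarded) is a connected line with $n$ nodes, without branches or loops; (ii) $x\in\mathbb R^n$ is a seed point whose decoration has exactly one square, placed at an extreme node $k$ of the line; that is, $r_k x\ne x$ and $r_i x=x$ for all $i\neq k$ (equivalently, $x$ is a nonzero multiple of the fundamental weight $\omega_k$). Let $P$ be the convex hull of the orbit $Wx$. By a face of a polytope we mean a nonempty set of maximizers of a linear functional over it. Then for every dimension $0\le d\le n-1$ the set of $d$-dimensional faces of $P$ is exactly one orbit of $W$, and $P$ is a Platonic polytope of dimension $n$. Here Platonic polytopes are defined recursively on the dimension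 $d$: a polytope $Q$ of dimension $d$ in $\mathbb R^n$ is Platonic if, up to a translation, it is the convex hull of the orbit of one point under a finite group $G$ generated by linear reflections, and for every $0\le e<d$ the $e$-dimensional faces of this convex hull form exactly one orbit of $G$ and are themselves Platonic polytopes of dimension $e$. -/

import Mathlib

open scoped Pointwise InnerProductSpace

noncomputable section

namespace CoxeterPolytope

section General

variable {E : Type*} [NormedAddCommGroup E] [InnerProductSpace ℝ E]

/-- The reflection `x ↦ x - 2 (⟪v, x⟫ / ⟪v, v⟫) v` in the hyperplane through the origin orthogonal
to `v` (see `rootReflection_apply`), as a linear isometry. -/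
def rootReflection (v : E) : E ≃ₗᵢ[ℝ] E := (ℝ ∙ v)ᗮ.reflection

theorem rootReflection_apply (v x : E) :
    rootReflection v x = x - (2 * ⟪v, x⟫_ℝ / ⟪v, v⟫_ℝ) • v := by
  rw [rootReflection, Submodule.reflection_orthogonal_apply, Submodule.reflection_singleton_apply,
    neg_sub, real_inner_self_eq_norm_sq, two_nsmul, ← add_smul]
  congr 2
  simp only [RCLike.ofReal_real_eq_id, id_eq]
  ring

/-- A (reduced, not necessarily crystallographic) finite root system in a Euclidean space. -/
structure IsRootSystem (Φ : Set E) : Prop where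
  finite : Φ.Finite
  ne_zero : ∀ a ∈ Φ, a ≠ 0
  reduced : ∀ a ∈ Φ, ∀ c : ℝ, c • a ∈ Φ → c = 1 ∨ c = -1
  reflection_mem : ∀ a ∈ Φ, ∀ b ∈ Φ, rootReflection a b ∈ Φ

/-- The family `α` is a system of simple roots of the root system `Φ`: its members are linearly
independent roots, and every root is a linear combination of them whose coefficients are
all nonnegative or all nonpositive. -/
structure IsSimpleSystem {ι : Type*} [Fintype ι] (Φ : Set E) (α : ι → E) : Prop where
  mem : ∀ i, α i ∈ Φ
  linearIndependent : LinearIndependent ℝ α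
  pos_or_neg : ∀ b ∈ Φ, ∃ c : ι → ℝ, b = ∑ i, c i • α i ∧ ((∀ i, 0 ≤ c i) ∨ (∀ i, c i ≤ 0))

/-- The Coxeter group generated by the reflections in the simple roots. -/
def coxeterGroup {ι : Type*} (α : ι → E) : Subgroup (E ≃ₗᵢ[ℝ] E) :=
  Subgroup.closure (Set.range fun i => rootReflection (α i))

/-- The underlying graph of the Coxeter–Dynkin diagram: the nodes are the simple roots, and two
distinct nodes are linked when the roots are not orthogonal. The multiplicities or labels of the
links are not recorded. -/
def diagram {ι : Type*} (α : ι → E) : SimpleGraph ι where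
  Adj i j := i ≠ j ∧ ⟪α i, α j⟫_ℝ ≠ 0
  symm := ⟨fun i j h => ⟨h.1.symm, by rw [real_inner_comm]; exact h.2⟩⟩
  loopless := ⟨fun _ h => h.1 rfl⟩

/-- The nodes carrying a square in the seed decoration given by the seed point `x`: those whose
reflection moves `x`. -/
def seedSquares {ι : Type*} (α : ι → E) (x : E) : Set ι :=
  {i | rootReflection (α i) x ≠ x}

/-- The polytope generated by `G` from the point `x`: the convex hull of the orbit of `x`. -/
def orbitPolytope (G : Subgroup (E ≃ₗᵢ[ℝ] E)) (x : E) : Set E :=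
  convexHull ℝ {y | ∃ g ∈ G, y = g x}

/-- The set of `d`-dimensional faces of the polytope `P`, where a face is the nonempty set of
maximizers over `P` of a linear functional. -/
def faces (P : Set E) (d : ℕ) : Set (Set E) :=
  {F | F.Nonempty ∧ IsExposed ℝ P F ∧ Module.finrank ℝ (vectorSpan ℝ F) = d}

/-- The family `𝓕` of subsets of `E` is exactly one orbit of `G`. -/
def IsSingleOrbit (G : Subgroup (E ≃ₗᵢ[ℝ] E)) (𝓕 : Set (Set E)) : Prop :=
  ∃ F₀, 𝓕 = {F | ∃ g ∈ G, F = g '' F₀}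

/-- Finite Coxeter groups acting on `E`: the finite groups generated by reflections. -/
def IsFiniteReflectionGroup (G : Subgroup (E ≃ₗᵢ[ℝ] E)) : Prop :=
  Finite G ∧ ∃ S : Set E, G = Subgroup.closure (rootReflection '' S)

/-- `IsPlatonic d P`: the set `P` is a Platonic polytope of dimension `d`. Up to a translation by
some `c`, it is generated from one point by a finite reflection group `G`, and, for every `e < d`,
its `e`-dimensional faces form one orbit of `G` and are Platonic polytopes of dimension `e`. -/
inductive IsPlatonic : ℕ → Set E → Prop
  | intro (d : ℕ) (P : Set E) (G : Subgroup (E ≃ₗᵢ[ℝ] E)) (c x : E)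
      (reflectionGroup : IsFiniteReflectionGroup G)
      (generated : P = c +ᵥ orbitPolytope G x)
      (dimension : Module.finrank ℝ (vectorSpan ℝ P) = d)
      (singleOrbit : ∀ e < d, IsSingleOrbit G (faces (orbitPolytope G x) e))
      (facesPlatonic : ∀ e < d, ∀ F ∈ faces (orbitPolytope G x) e, IsPlatonic e F) :
      IsPlatonic d P

end General

end CoxeterPolytope

end

noncomputable section

namespace CoxeterPolytope

variable {E : Type*} [NormedAddCommGroup E] [InnerProductSpace ℝ E]

/-! Every face is cut out by a functional `⟪v, ·⟫`, and some element of `W` makes `v` dominant. For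
dominant `v` and dominant seed `x`, the maximizers on the orbit form the orbit of `x` under the
parabolic subgroup of the simple roots orthogonal to `v` (`exists_parabolic_apply_eq`); this rests
on `x - g x` being a nonnegative combination of simple roots, a consequence of the exchange
property. Number the line from the square and let `d` be the first node not orthogonal to `v`.
Reflections beyond `d` fix `x` and commute with those before `d`, so the face is the orbit polytope
of the first `d` nodes (`maximizers_eq`). Its dimension is `d` because the segment is connected to
the square (`vectorSpan_orbitPolytope`). Hence the dimension determines the face up to `W`
(`faces_eq`). The faces have the same form for a shorter path, so induction proves the Platonic
property. For this, `IsSeededPath` neither mentions a root system nor asks the roots to span the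
space. -/

theorem rootReflection_mul_self (v : E) : rootReflection v * rootReflection v = 1 := by
  ext1 x
  rw [LinearIsometryEquiv.coe_mul, Function.comp_apply]
  exact Submodule.reflection_reflection _ x

theorem rootReflection_inv (v : E) : (rootReflection v)⁻¹ = rootReflection v :=
  inv_eq_of_mul_eq_one_left (rootReflection_mul_self v)

theorem mul_rootReflection_mul_inv (g : E ≃ₗᵢ[ℝ] E) (v : E) :
    g * rootReflection v * g⁻¹ = rootReflection (g v) := by
  ext x
  obtain ⟨y, rfl⟩ := g.surjective x
  have h : g⁻¹ (g y) = y := g.symm_apply_apply y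
  simp only [LinearIsometryEquiv.coe_mul, Function.comp_apply, h, rootReflection_apply,
    LinearIsometryEquiv.inner_map_map, map_sub, map_smul]

theorem rootReflection_neg (v : E) : rootReflection (-v) = rootReflection v := by
  ext x
  simp [rootReflection_apply, neg_div]

theorem rootReflection_smul {c : ℝ} (hc : c ≠ 0) (v : E) :
    rootReflection (c • v) = rootReflection v := by
  simp only [rootReflection, Submodule.span_singleton_smul_eq (IsUnit.mk0 c hc)]

theorem rootReflection_eq_self {v x : E} (h : ⟪v, x⟫_ℝ = 0) : rootReflection v x = x := by
  simp [rootReflection_apply, h]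

theorem rootReflection_ne_self_iff {v x : E} (hv : v ≠ 0) :
    rootReflection v x ≠ x ↔ ⟪v, x⟫_ℝ ≠ 0 := by
  rw [rootReflection_apply, Ne, sub_eq_self, smul_eq_zero, not_or]
  simp [hv]

theorem inner_rootReflection (v x y : E) :
    ⟪y, rootReflection v x⟫_ℝ = ⟪y, x⟫_ℝ - 2 * ⟪v, x⟫_ℝ / ⟪v, v⟫_ℝ * ⟪y, v⟫_ℝ := by
  rw [rootReflection_apply, inner_sub_right, real_inner_smul_right]

/-- If `⟪y, ·⟫` is positive at `v` and does not increase from `x` to its mirror image in `v`, then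
`x` lies on the nonnegative side of the mirror. -/
theorem inner_nonneg_of_inner_rootReflection_le {v x y : E} (hy : 0 < ⟪y, v⟫_ℝ)
    (h : ⟪y, rootReflection v x⟫_ℝ ≤ ⟪y, x⟫_ℝ) : 0 ≤ ⟪v, x⟫_ℝ := by
  have hv : 0 < ⟪v, v⟫_ℝ := real_inner_self_pos.2 (by rintro rfl; simp at hy)
  rw [inner_rootReflection] at h
  by_contra! hneg
  have : 2 * ⟪v, x⟫_ℝ / ⟪v, v⟫_ℝ < 0 := div_neg_of_neg_of_pos (by linarith) hv
  nlinarith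

/-- Independence allows any values on the roots; extend from the span and apply Riesz. It supplies
the vector `ρ` pairing to `1` with every simple root and the functionals that cut out faces. -/
theorem exists_forall_inner_eq {ι : Type*} [FiniteDimensional ℝ E] {α : ι → E} (hα : LinearIndependent ℝ α)
    (t : ι → ℝ) : ∃ v : E, ∀ i, ⟪α i, v⟫_ℝ = t i := by
  obtain ⟨f, hf⟩ := LinearMap.exists_extend ((Module.Basis.span hα).constr ℝ t)
  refine ⟨(InnerProductSpace.toDual ℝ E).symm f.toContinuousLinearMap, fun i => ?_⟩
  rw [real_inner_comm, InnerProductSpace.toDual_symm_apply]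
  have h := LinearMap.congr_fun hf (Module.Basis.span hα i)
  rw [Module.Basis.constr_basis, LinearMap.comp_apply, Submodule.subtype_apply,
    Module.Basis.span_apply] at h
  exact h

/-! ### Words and conjugation in reflection groups -/

section Family

variable {ι : Type*}

theorem rootReflection_mem_coxeterGroup (α : ι → E) (i : ι) :
    rootReflection (α i) ∈ coxeterGroup α :=
  Subgroup.subset_closure ⟨i, rfl⟩

/-- The product of the simple reflections along a word. -/
def wordProd (α : ι → E) (w : List ι) : E ≃ₗᵢ[ℝ] E :=
  (w.map fun i => rootReflection (α i)).prod

theorem exists_wordProd_eq {α : ι → E} {g : E ≃ₗᵢ[ℝ] E} (hg : g ∈ coxeterGroup α) :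
    ∃ w, wordProd α w = g := by
  induction hg using Subgroup.closure_induction with
  | mem x hx => obtain ⟨i, rfl⟩ := hx; exact ⟨[i], by simp [wordProd]⟩
  | one => exact ⟨[], by simp [wordProd]⟩
  | mul x y _ _ hx hy =>
    obtain ⟨u, rfl⟩ := hx
    obtain ⟨w, rfl⟩ := hy
    exact ⟨u ++ w, by simp [wordProd]⟩
  | inv x _ hx =>
    obtain ⟨u, rfl⟩ := hx
    refine ⟨u.reverse, ?_⟩
    simp only [wordProd, List.prod_inv_reverse, List.map_map, List.map_reverse]
    simp only [Function.comp_def, rootReflection_inv]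

theorem wordProd_mem (α : ι → E) (w : List ι) : wordProd α w ∈ coxeterGroup α := by
  apply Subgroup.list_prod_mem
  intro g hg
  obtain ⟨i, -, rfl⟩ := List.mem_map.1 hg
  exact rootReflection_mem_coxeterGroup α i

/-- A set stable under the generating reflections is stable under the group. -/
theorem apply_mem_of_forall_rootReflection_mem {α : ι → E} {S : Set E}
    (hS : ∀ i, ∀ y ∈ S, rootReflection (α i) y ∈ S) {g : E ≃ₗᵢ[ℝ] E} (hg : g ∈ coxeterGroup α)
    {y : E} (hy : y ∈ S) : g y ∈ S := by
  obtain ⟨w, rfl⟩ := exists_wordProd_eq hg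
  induction w with
  | nil => simpa [wordProd] using hy
  | cons i w ih => simpa [wordProd] using hS i _ (ih (wordProd_mem α w))

theorem coxeterGroup_comp_le {κ : Type*} (α : ι → E) (f : κ → ι) :
    coxeterGroup (fun j => α (f j)) ≤ coxeterGroup α := by
  refine Subgroup.closure_mono ?_
  rintro _ ⟨j, rfl⟩
  exact ⟨f j, rfl⟩

theorem mem_coxeterGroup_map {α : ι → E} (g : E ≃ₗᵢ[ℝ] E) {h : E ≃ₗᵢ[ℝ] E} :
    h ∈ coxeterGroup (fun i => g (α i)) ↔ g⁻¹ * h * g ∈ coxeterGroup α := by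
  have key : coxeterGroup (fun i => g (α i)) =
      (coxeterGroup α).map (MulAut.conj g).toMonoidHom := by
    rw [coxeterGroup, coxeterGroup, MonoidHom.map_closure, ← Set.range_comp]
    congr 2
    funext i
    exact (mul_rootReflection_mul_inv g (α i)).symm
  rw [key, Subgroup.mem_map]
  constructor
  · rintro ⟨k, hk, rfl⟩
    simpa [mul_assoc] using hk
  · intro hk
    exact ⟨_, hk, by simp [mul_assoc]⟩

theorem orbitPolytope_map (α : ι → E) (g : E ≃ₗᵢ[ℝ] E) (x : E) :
    orbitPolytope (coxeterGroup fun i => g (α i)) (g x) =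
      g '' orbitPolytope (coxeterGroup α) x := by
  rw [orbitPolytope, orbitPolytope]
  have := (g.toLinearEquiv.toLinearMap).image_convexHull {y | ∃ h ∈ coxeterGroup α, y = h x}
  refine Eq.trans ?_ this.symm
  congr 1
  ext y
  constructor
  · rintro ⟨h, hh, rfl⟩
    refine ⟨_, ⟨_, (mem_coxeterGroup_map g).1 hh, rfl⟩, ?_⟩
    exact g.apply_symm_apply _
  · rintro ⟨_, ⟨h, hh, rfl⟩, rfl⟩
    refine ⟨g * h * g⁻¹, (mem_coxeterGroup_map g).2 (by simpa [mul_assoc] using hh), ?_⟩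
    change g (h x) = g (h (g.symm (g x)))
    rw [g.symm_apply_apply]

end Family

/-! ### Positive systems, exchange and dominance -/

section Cone

variable {ι : Type*} [Fintype ι]

/-- The cone of the nonnegative linear combinations of a finite family. -/
def positiveCone (α : ι → E) : Set E :=
  {b | ∃ c : ι → ℝ, (∀ i, 0 ≤ c i) ∧ b = ∑ i, c i • α i}

theorem add_mem_positiveCone {α : ι → E} {a b : E} (ha : a ∈ positiveCone α)
    (hb : b ∈ positiveCone α) : a + b ∈ positiveCone α := by
  obtain ⟨c, hc, rfl⟩ := ha
  obtain ⟨d, hd, rfl⟩ := hb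
  exact ⟨fun i => c i + d i, fun i => add_nonneg (hc i) (hd i),
    by simp [add_smul, Finset.sum_add_distrib]⟩

theorem smul_mem_positiveCone {α : ι → E} {a : E} (ha : a ∈ positiveCone α) {t : ℝ}
    (ht : 0 ≤ t) : t • a ∈ positiveCone α := by
  obtain ⟨c, hc, rfl⟩ := ha
  exact ⟨fun i => t * c i, fun i => mul_nonneg ht (hc i), by simp [mul_smul, Finset.smul_sum]⟩

theorem zero_mem_positiveCone (α : ι → E) : (0 : E) ∈ positiveCone α :=
  ⟨fun _ => 0, fun _ => le_rfl, by simp⟩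

theorem mem_positiveCone_self (α : ι → E) (i : ι) : α i ∈ positiveCone α := by
  classical
  exact ⟨fun j => if j = i then 1 else 0, fun j => by beta_reduce; split_ifs <;> simp, by simp⟩

theorem eq_zero_of_mem_positiveCone {α : ι → E} (hα : LinearIndependent ℝ α) {b : E}
    (hb : b ∈ positiveCone α) (hb' : -b ∈ positiveCone α) : b = 0 := by
  obtain ⟨c, hc, rfl⟩ := hb
  obtain ⟨d, hd, hcd⟩ := hb'
  have h : ∑ i, (c i + d i) • α i = 0 := by
    simp only [add_smul, Finset.sum_add_distrib, ← hcd, add_neg_cancel]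
  have h0 := Fintype.linearIndependent_iff.1 hα _ h
  refine Finset.sum_eq_zero fun i _ => ?_
  rw [show c i = 0 by linarith [hc i, hd i, h0 i], zero_smul]

theorem inner_nonneg_of_mem_positiveCone {α : ι → E} {v b : E} (hv : ∀ i, 0 ≤ ⟪α i, v⟫_ℝ)
    (hb : b ∈ positiveCone α) : 0 ≤ ⟪v, b⟫_ℝ := by
  obtain ⟨c, hc, rfl⟩ := hb
  rw [inner_sum]
  refine Finset.sum_nonneg fun i _ => ?_
  rw [real_inner_smul_right, real_inner_comm]
  exact mul_nonneg (hc i) (hv i)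

/-- The only positive vectors that a simple reflection makes negative are the multiples of its
simple root. -/
theorem exists_eq_smul_of_neg_rootReflection_mem {α : ι → E} (hα : LinearIndependent ℝ α) {b : E}
    {j : ι} (hb : b ∈ positiveCone α) (hb' : -(rootReflection (α j) b) ∈ positiveCone α) :
    ∃ c : ℝ, b = c • α j := by
  classical
  obtain ⟨c, hc, hbc⟩ := hb
  obtain ⟨d, hd, hbd⟩ := hb'
  rw [rootReflection_apply] at hbd
  set t := 2 * ⟪α j, b⟫_ℝ / ⟪α j, α j⟫_ℝ
  -- The reflection alters only the `j`-th coefficient, so away from `j` the nonnegative numbers `c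
  -- i` and `d i` sum to zero.
  have h : ∑ i, (c i + d i - if i = j then t else 0) • α i = 0 := by
    simp only [add_smul, sub_smul, Finset.sum_add_distrib, Finset.sum_sub_distrib, ← hbd, ← hbc,
      ite_smul, zero_smul, Finset.sum_ite_eq', Finset.mem_univ, if_true]
    abel
  have h0 := Fintype.linearIndependent_iff.1 hα _ h
  refine ⟨c j, ?_⟩
  rw [hbc]
  refine Finset.sum_eq_single j (fun i _ hij => ?_) (by simp)
  have := h0 i
  rw [if_neg hij] at this
  rw [show c i = 0 by linarith [hc i, hd i], zero_smul]

/-- A linearly independent family is a positive system if its Coxeter group is finite and maps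
every member of the family to a nonnegative or a nonpositive combination. -/
structure IsPositiveSystem (α : ι → E) : Prop where
  linearIndependent : LinearIndependent ℝ α
  finite : Finite (coxeterGroup α)
  pos_or_neg : ∀ g ∈ coxeterGroup α, ∀ i, g (α i) ∈ positiveCone α ∨ -g (α i) ∈ positiveCone α

/-- The exchange property: a word taking a simple root to a negative vector is, after
multiplication by the reflection of that root, the product of a shorter word. -/
theorem IsPositiveSystem.exists_wordProd_mul_eq {α : ι → E} (hα : IsPositiveSystem α) (i : ι)
    (w : List ι) (hw : -(wordProd α w (α i)) ∈ positiveCone α) :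
    ∃ u : List ι, u.length < w.length ∧
      wordProd α u = wordProd α w * rootReflection (α i) := by
  induction w with
  | nil =>
    refine absurd (eq_zero_of_mem_positiveCone hα.linearIndependent
      (mem_positiveCone_self α i) ?_) (hα.linearIndependent.ne_zero i)
    simpa [wordProd] using hw
  | cons j w ih =>
    have hcons : wordProd α (j :: w) = rootReflection (α j) * wordProd α w := by simp [wordProd]
    rw [hcons] at hw ⊢
    rcases hα.pos_or_neg _ (wordProd_mem α w) i with hpos | hneg
    -- The sign changes exactly at the letter `j`, so `w` sends `α i` to a multiple of `α j`.
    -- Conjugation turns the reflection of `α i` into that of `α j`, and the letter `j` cancels.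
    · obtain ⟨c, hc⟩ := exists_eq_smul_of_neg_rootReflection_mem hα.linearIndependent hpos hw
      have hc0 : c ≠ 0 := by
        rintro rfl
        rw [zero_smul, map_eq_zero_iff _ (wordProd α w).injective] at hc
        exact hα.linearIndependent.ne_zero i hc
      refine ⟨w, by simp, ?_⟩
      have h := mul_rootReflection_mul_inv (wordProd α w) (α i)
      rw [hc, rootReflection_smul hc0, mul_inv_eq_iff_eq_mul] at h
      rw [mul_assoc, h, ← mul_assoc, rootReflection_mul_self, one_mul]
    · obtain ⟨u, hu, hu'⟩ := ih hneg
      refine ⟨j :: u, by simpa using hu, ?_⟩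
      simp only [wordProd, List.map_cons, List.prod_cons] at hu' ⊢
      rw [hu', mul_assoc]

/-- Induct on word length. Appending the letter `i` to `u` adds a nonnegative multiple of `u (α i)`
to the difference; if that vector is negative, exchange provides a shorter word for the same
element. -/
theorem IsPositiveSystem.sub_apply_mem_positiveCone {α : ι → E} (hα : IsPositiveSystem α) {x : E}
    (hx : ∀ i, 0 ≤ ⟪α i, x⟫_ℝ) {g : E ≃ₗᵢ[ℝ] E} (hg : g ∈ coxeterGroup α) :
    x - g x ∈ positiveCone α := by
  obtain ⟨w, rfl⟩ := exists_wordProd_eq hg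
  clear hg
  induction hn : w.length using Nat.strong_induction_on generalizing w with
  | _ n ih =>
    rcases List.eq_nil_or_concat w with rfl | ⟨u, i, rfl⟩
    · simpa [wordProd] using zero_mem_positiveCone α
    have hprod : wordProd α (u.concat i) = wordProd α u * rootReflection (α i) := by
      simp [wordProd]
    rw [List.length_concat] at hn
    rcases hα.pos_or_neg _ (wordProd_mem α u) i with hpos | hneg
    · have key : x - wordProd α (u.concat i) x = (x - wordProd α u x) +
          (2 * ⟪α i, x⟫_ℝ / ⟪α i, α i⟫_ℝ) • wordProd α u (α i) := by
        rw [hprod, LinearIsometryEquiv.coe_mul, Function.comp_apply, rootReflection_apply, map_sub,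
          map_smul]
        abel
      rw [key]
      refine add_mem_positiveCone (ih u.length (by omega) u rfl) (smul_mem_positiveCone hpos ?_)
      exact div_nonneg (mul_nonneg zero_le_two (hx i)) real_inner_self_nonneg
    · obtain ⟨w', hw', h⟩ := hα.exists_wordProd_mul_eq i u hneg
      rw [hprod, ← h]
      exact ih w'.length (by omega) w' rfl

/-- Both `x - g x` and its negative lie in the cone, which contains no line. -/
theorem IsPositiveSystem.apply_eq_self_of_dominant {α : ι → E} (hα : IsPositiveSystem α) {x : E}
    (hx : ∀ i, 0 ≤ ⟪α i, x⟫_ℝ) {g : E ≃ₗᵢ[ℝ] E} (hg : g ∈ coxeterGroup α)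
    (hgx : ∀ i, 0 ≤ ⟪α i, g x⟫_ℝ) : g x = x := by
  have h := hα.sub_apply_mem_positiveCone hgx (inv_mem hg)
  rw [show g⁻¹ (g x) = x from g.symm_apply_apply x] at h
  refine (sub_eq_zero.1 (eq_zero_of_mem_positiveCone hα.linearIndependent
    (hα.sub_apply_mem_positiveCone hx hg) ?_)).symm
  rwa [neg_sub]

theorem IsPositiveSystem.inner_apply_le {α : ι → E} (hα : IsPositiveSystem α) {v x : E}
    (hv : ∀ i, 0 ≤ ⟪α i, v⟫_ℝ) (hx : ∀ i, 0 ≤ ⟪α i, x⟫_ℝ) {g : E ≃ₗᵢ[ℝ] E}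
    (hg : g ∈ coxeterGroup α) : ⟪v, g x⟫_ℝ ≤ ⟪v, x⟫_ℝ := by
  have := inner_nonneg_of_mem_positiveCone hv (hα.sub_apply_mem_positiveCone hx hg)
  rwa [inner_sub_right, sub_nonneg] at this

/-- Take `g` maximizing `⟪ρ, g v⟫`: a simple root pairing negatively with `g v` would give a
reflection that increases this value. -/
theorem exists_dominant_apply [FiniteDimensional ℝ E] {α : ι → E} (hα : IsPositiveSystem α)
    (v : E) : ∃ g ∈ coxeterGroup α, ∀ i, 0 ≤ ⟪α i, g v⟫_ℝ := by
  obtain ⟨ρ, hρ⟩ := exists_forall_inner_eq hα.linearIndependent fun _ => 1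
  have := hα.finite
  obtain ⟨g, hg⟩ := Finite.exists_max fun g : coxeterGroup α => ⟪ρ, g.1 v⟫_ℝ
  refine ⟨g, g.2, fun i => inner_nonneg_of_inner_rootReflection_le (y := ρ) ?_
    (hg ⟨_, mul_mem (rootReflection_mem_coxeterGroup α i) g.2⟩)⟩
  rw [real_inner_comm, hρ]
  exact one_pos

/-- Over the orbit of a dominant point, a dominant functional is maximal exactly at the translates
by the parabolic subgroup that fixes it. -/
theorem IsPositiveSystem.exists_parabolic_apply_eq [FiniteDimensional ℝ E] {α : ι → E}
    (hα : IsPositiveSystem α) {v x : E} (hv : ∀ i, 0 ≤ ⟪α i, v⟫_ℝ) (hx : ∀ i, 0 ≤ ⟪α i, x⟫_ℝ)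
    {g : E ≃ₗᵢ[ℝ] E} (hg : g ∈ coxeterGroup α) (hgx : ⟪v, g x⟫_ℝ = ⟪v, x⟫_ℝ) :
    ∃ h ∈ coxeterGroup (fun i : {i // ⟪α i, v⟫_ℝ = 0} => α i), g x = h x := by
  set H := coxeterGroup (fun i : {i // ⟪α i, v⟫_ℝ = 0} => α i)
  have hH : H ≤ coxeterGroup α := coxeterGroup_comp_le α Subtype.val
  obtain ⟨ρ, hρ⟩ := exists_forall_inner_eq hα.linearIndependent fun _ => 1
  have := hα.finite
  have : Finite H := Finite.of_injective _ (Subgroup.inclusion_injective hH)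
  -- Maximizing `ρ` over the parabolic subgroup makes `h (g x)` dominant for the roots orthogonal to
  -- `v`. For the other roots `v` plays the role of `ρ`, since `⟪v, h (g x)⟫` is already maximal on
  -- the whole orbit.
  obtain ⟨⟨h, hh⟩, hmax⟩ := Finite.exists_max fun h : H => ⟪ρ, h.1 (g x)⟫_ℝ
  have hfix : ⟪v, h (g x)⟫_ℝ = ⟪v, x⟫_ℝ := by
    refine apply_mem_of_forall_rootReflection_mem (S := {y | ⟪v, y⟫_ℝ = ⟪v, x⟫_ℝ}) ?_ hh hgx
    intro i y hy
    rw [Set.mem_ofPred_eq, inner_rootReflection, real_inner_comm (α i) v, i.2, mul_zero, sub_zero]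
    exact hy
  have hdom : ∀ i, 0 ≤ ⟪α i, (h * g) x⟫_ℝ := by
    intro i
    by_cases hi : ⟪α i, v⟫_ℝ = 0
    · refine inner_nonneg_of_inner_rootReflection_le (y := ρ) ?_
        (hmax ⟨_, mul_mem
          (rootReflection_mem_coxeterGroup (fun i : {i // ⟪α i, v⟫_ℝ = 0} => α i) ⟨i, hi⟩) hh⟩)
      rw [real_inner_comm, hρ]
      exact one_pos
    · refine inner_nonneg_of_inner_rootReflection_le (y := v) ?_ ?_
      · rw [real_inner_comm]
        exact lt_of_le_of_ne (hv i) (Ne.symm hi)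
      · refine le_trans ?_ hfix.ge
        exact hα.inner_apply_le hv hx (mul_mem (rootReflection_mem_coxeterGroup α i)
          (mul_mem (hH hh) hg))
  have heq := hα.apply_eq_self_of_dominant hx (mul_mem (hH hh) hg) hdom
  refine ⟨h⁻¹, inv_mem hh, ?_⟩
  exact (h.symm_apply_eq.2 heq.symm).symm

end Cone

/-! ### Exposed faces of convex hulls and of orbit polytopes -/

section Faces

/-- The maximizers over `P` of the linear functional `⟪v, ·⟫`. -/
def maximizers (P : Set E) (v : E) : Set E :=
  {y ∈ P | ∀ z ∈ P, ⟪v, z⟫_ℝ ≤ ⟪v, y⟫_ℝ}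

theorem isExposed_maximizers (P : Set E) (v : E) : IsExposed ℝ P (maximizers P v) :=
  fun _ => ⟨innerSL ℝ v, rfl⟩

theorem exists_eq_maximizers [FiniteDimensional ℝ E] {P F : Set E} (hF : IsExposed ℝ P F)
    (hne : F.Nonempty) : ∃ v, F = maximizers P v := by
  obtain ⟨l, hl⟩ := hF hne
  refine ⟨(InnerProductSpace.toDual ℝ E).symm l, ?_⟩
  simp only [maximizers, InnerProductSpace.toDual_symm_apply]
  exact hl

theorem image_maximizers (g : E ≃ₗᵢ[ℝ] E) (P : Set E) (v : E) :
    g '' maximizers P v = maximizers (g '' P) (g v) := by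
  ext y
  obtain ⟨y, rfl⟩ := g.surjective y
  simp [maximizers, g.injective.mem_set_image]

theorem finrank_vectorSpan_image (g : E ≃ₗᵢ[ℝ] E) (F : Set E) :
    Module.finrank ℝ (vectorSpan ℝ (g '' F)) = Module.finrank ℝ (vectorSpan ℝ F) := by
  have h := g.toLinearEquiv.toLinearMap.toAffineMap.map_vectorSpan (s := F)
  change Submodule.map (g.toLinearEquiv : E →ₗ[ℝ] E) _ = vectorSpan ℝ (g '' F) at h
  rw [← h]
  exact LinearEquiv.finrank_map_eq _ _

theorem sep_le_convexHull {S : Set E} {v : E} {M : ℝ} (hS : ∀ y ∈ S, ⟪v, y⟫_ℝ ≤ M) :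
    {y ∈ convexHull ℝ S | M ≤ ⟪v, y⟫_ℝ} = convexHull ℝ {y ∈ S | ⟪v, y⟫_ℝ = M} := by
  have hlin : IsLinearMap ℝ fun y : E => ⟪v, y⟫_ℝ := (innerₗ E v).isLinear
  have hM : ∀ y ∈ convexHull ℝ {y ∈ S | ⟪v, y⟫_ℝ = M}, ⟪v, y⟫_ℝ = M :=
    fun y hy => convexHull_min (fun z hz => hz.2) (convex_hyperplane hlin M) hy
  refine Set.Subset.antisymm ?_ fun y hy => ⟨convexHull_mono (Set.sep_subset _ _) hy, (hM y hy).ge⟩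
  -- A proper convex combination reaches level `M` only if both points do; this set is therefore
  -- convex, and it contains `S`.
  have hT : Convex ℝ ({y | ⟪v, y⟫_ℝ < M} ∪ convexHull ℝ {y ∈ S | ⟪v, y⟫_ℝ = M}) := by
    refine convex_iff_forall_pos.2 fun y hy z hz a b ha hb hab => ?_
    have hle : ∀ y ∈ {y | ⟪v, y⟫_ℝ < M} ∪ convexHull ℝ {y ∈ S | ⟪v, y⟫_ℝ = M}, ⟪v, y⟫_ℝ ≤ M := by
      rintro y (hy | hy)
      · exact le_of_lt hy
      · exact (hM y hy).le
    have hsplit : M = a * M + b * M := by rw [← add_mul, hab, one_mul]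
    have hexp : ⟪v, a • y + b • z⟫_ℝ = a * ⟪v, y⟫_ℝ + b * ⟪v, z⟫_ℝ := by
      rw [inner_add_right, real_inner_smul_right, real_inner_smul_right]
    rcases hy with hy' | hy'
    · left
      change ⟪v, _⟫_ℝ < M
      have h1 := mul_lt_mul_of_pos_left (show ⟪v, y⟫_ℝ < M from hy') ha
      have h2 := mul_le_mul_of_nonneg_left (hle z hz) hb.le
      linarith
    rcases hz with hz' | hz'
    · left
      change ⟪v, _⟫_ℝ < M
      have h1 := mul_lt_mul_of_pos_left (show ⟪v, z⟫_ℝ < M from hz') hb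
      have h2 := mul_le_mul_of_nonneg_left (hle y (Or.inr hy')) ha.le
      linarith
    · exact Or.inr (convex_convexHull ℝ _ hy' hz' ha.le hb.le hab)
  have hsub : S ⊆ {y | ⟪v, y⟫_ℝ < M} ∪ convexHull ℝ {y ∈ S | ⟪v, y⟫_ℝ = M} := fun z hz =>
    (hS z hz).lt_or_eq.imp id fun h => subset_convexHull ℝ _ ⟨hz, h⟩
  rintro y ⟨hy, hle⟩
  exact (convexHull_min hsub hT hy).resolve_left (not_lt.2 hle)

theorem apply_mem_orbitPolytope {G : Subgroup (E ≃ₗᵢ[ℝ] E)} {g : E ≃ₗᵢ[ℝ] E} (hg : g ∈ G) (x : E) :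
    g x ∈ orbitPolytope G x :=
  subset_convexHull ℝ _ ⟨g, hg, rfl⟩

theorem self_mem_orbitPolytope (G : Subgroup (E ≃ₗᵢ[ℝ] E)) (x : E) : x ∈ orbitPolytope G x :=
  apply_mem_orbitPolytope (one_mem G) x

theorem image_orbitPolytope {G : Subgroup (E ≃ₗᵢ[ℝ] E)} {g : E ≃ₗᵢ[ℝ] E} (hg : g ∈ G) (x : E) :
    g '' orbitPolytope G x = orbitPolytope G x := by
  refine (g.toLinearEquiv.toLinearMap.image_convexHull {y | ∃ h ∈ G, y = h x}).trans ?_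
  rw [orbitPolytope]
  congr 1
  ext y
  constructor
  · rintro ⟨_, ⟨h, hh, rfl⟩, rfl⟩
    exact ⟨g * h, mul_mem hg hh, rfl⟩
  · rintro ⟨h, hh, rfl⟩
    exact ⟨g⁻¹ (h x), ⟨g⁻¹ * h, mul_mem (inv_mem hg) hh, rfl⟩, g.apply_symm_apply _⟩

end Faces

/-! ### Orbit polytopes of seeded paths -/

section SeededPath

theorem apply_sub_mem_span {ι : Type*} (α : ι → E) {g : E ≃ₗᵢ[ℝ] E} (hg : g ∈ coxeterGroup α)
    (y : E) : g y - y ∈ Submodule.span ℝ (Set.range α) := by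
  refine apply_mem_of_forall_rootReflection_mem
    (S := {z | z - y ∈ Submodule.span ℝ (Set.range α)}) (fun i z hz => ?_) hg (by simp)
  rw [Set.mem_ofPred_eq, rootReflection_apply, sub_right_comm]
  exact Submodule.sub_mem _ hz (Submodule.smul_mem _ _ (Submodule.subset_span ⟨i, rfl⟩))

/-- By independence the coefficients over the subfamily are those over `α`. This lets a subfamily
inherit positivity. -/
theorem mem_positiveCone_comp {ι κ : Type*} [Fintype ι] [Fintype κ] {α : ι → E}
    (hα : LinearIndependent ℝ α) {f : κ → ι} (hf : f.Injective) {b : E}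
    (hb : b ∈ positiveCone α) (hspan : b ∈ Submodule.span ℝ (Set.range fun j => α (f j))) :
    b ∈ positiveCone fun j => α (f j) := by
  classical
  obtain ⟨c, hc, rfl⟩ := hb
  obtain ⟨d, hd⟩ := (Submodule.mem_span_range_iff_exists_fun ℝ).1 hspan
  have hsum : ∑ j, d j • α (f j) = ∑ i, (∑ j, if f j = i then d j else 0) • α i := by
    simp only [Finset.sum_smul]
    rw [Finset.sum_comm]
    refine Finset.sum_congr rfl fun j _ => ?_
    simp [ite_smul]
  rw [hsum, ← sub_eq_zero, ← Finset.sum_sub_distrib] at hd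
  simp only [← sub_smul] at hd
  refine ⟨d, fun j => ?_, ?_⟩
  · have := Fintype.linearIndependent_iff.1 hα _ hd (f j)
    simp only [hf.eq_iff, Finset.sum_ite_eq', Finset.mem_univ, if_true, sub_eq_zero] at this
    rw [this]
    exact hc _
  · rw [hsum, eq_comm, ← sub_eq_zero, ← Finset.sum_sub_distrib]
    simpa only [← sub_smul] using hd

/-- A positive system whose diagram is the path `0, 1, …, m - 1`, together with a seed point on the
positive side of the first root and orthogonal to the other roots. -/
structure IsSeededPath {m : ℕ} (α : Fin m → E) (x : E) : Prop extends IsPositiveSystem α where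
  inner_ne_zero : ∀ i j : Fin m, (i : ℕ) + 1 = j → ⟪α i, α j⟫_ℝ ≠ 0
  inner_eq_zero : ∀ i j : Fin m, (i : ℕ) + 1 < j → ⟪α i, α j⟫_ℝ = 0
  seed_pos : ∀ i : Fin m, (i : ℕ) = 0 → 0 < ⟪α i, x⟫_ℝ
  seed_eq_zero : ∀ i : Fin m, (i : ℕ) ≠ 0 → ⟪α i, x⟫_ℝ = 0

namespace IsSeededPath

variable {m : ℕ} {α : Fin m → E} {x : E}

theorem seed_nonneg (h : IsSeededPath α x) (i : Fin m) : 0 ≤ ⟪α i, x⟫_ℝ := by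
  by_cases hi : (i : ℕ) = 0
  · exact (h.seed_pos i hi).le
  · exact (h.seed_eq_zero i hi).ge

theorem map (h : IsSeededPath α x) (g : E ≃ₗᵢ[ℝ] E) :
    IsSeededPath (fun i => g (α i)) (g x) where
  linearIndependent := h.linearIndependent.map' g.toLinearEquiv.toLinearMap g.toLinearEquiv.ker
  finite := by
    have := h.finite
    refine Finite.of_injective (β := coxeterGroup α)
      (fun k => ⟨g⁻¹ * k.1 * g, (mem_coxeterGroup_map g).1 k.2⟩) fun a b hab => ?_
    exact Subtype.ext (mul_left_cancel (mul_right_cancel (congrArg Subtype.val hab)))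
  pos_or_neg k hk i := by
    have key : ∀ b ∈ positiveCone α, g b ∈ positiveCone fun i => g (α i) := by
      rintro _ ⟨c, hc, rfl⟩
      exact ⟨c, hc, by simp⟩
    have hk' : g ((g⁻¹ * k * g) (α i)) = k (g (α i)) := g.apply_symm_apply _
    rw [← hk', ← map_neg]
    exact (h.pos_or_neg _ ((mem_coxeterGroup_map g).1 hk) i).imp (key _) (key _)
  inner_ne_zero i j := by simpa using h.inner_ne_zero i j
  inner_eq_zero i j := by simpa using h.inner_eq_zero i j
  seed_pos i := by simpa using h.seed_pos i
  seed_eq_zero i := by simpa using h.seed_eq_zero i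

theorem initial (h : IsSeededPath α x) {d : ℕ} (hd : d ≤ m) :
    IsSeededPath (fun i => α (Fin.castLE hd i)) x where
  linearIndependent := h.linearIndependent.comp _ (Fin.castLE_injective hd)
  finite := by
    have := h.finite
    exact Finite.of_injective _
      (Subgroup.inclusion_injective (coxeterGroup_comp_le α (Fin.castLE hd)))
  pos_or_neg g hg i := by
    have hspan : g (α (Fin.castLE hd i)) ∈
        Submodule.span ℝ (Set.range fun j => α (Fin.castLE hd j)) := by
      have := Submodule.add_mem _ (apply_sub_mem_span _ hg (α (Fin.castLE hd i)))
        (Submodule.subset_span ⟨i, rfl⟩)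
      rwa [sub_add_cancel] at this
    refine (h.pos_or_neg g (coxeterGroup_comp_le α _ hg) (Fin.castLE hd i)).imp (fun hb => ?_) fun hb => ?_
    · exact mem_positiveCone_comp h.linearIndependent (Fin.castLE_injective hd) hb hspan
    · exact mem_positiveCone_comp h.linearIndependent (Fin.castLE_injective hd) hb
        (Submodule.neg_mem _ hspan)
  inner_ne_zero i j hij := h.inner_ne_zero _ _ hij
  inner_eq_zero i j hij := h.inner_eq_zero _ _ hij
  seed_pos i hi := h.seed_pos _ hi
  seed_eq_zero i hi := h.seed_eq_zero _ hi

/-- Differences of orbit points lie in the span of the roots. Conversely, the direction space is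
stable under the reflections, so it contains each root not orthogonal to it: the first because of
the seed, then each next one along the path. -/
theorem vectorSpan_orbitPolytope (h : IsSeededPath α x) :
    vectorSpan ℝ (orbitPolytope (coxeterGroup α) x) = Submodule.span ℝ (Set.range α) := by
  rw [orbitPolytope, ← direction_affineSpan, affineSpan_convexHull, direction_affineSpan]
  set S := {y | ∃ g ∈ coxeterGroup α, y = g x}
  apply le_antisymm
  · rw [vectorSpan_def, Submodule.span_le]
    rintro _ ⟨_, ⟨g, hg, rfl⟩, _, ⟨k, hk, rfl⟩, rfl⟩
    have := Submodule.sub_mem _ (apply_sub_mem_span α hg x) (apply_sub_mem_span α hk x)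
    rwa [sub_sub_sub_cancel_right] at this
  · have hinv : ∀ i, ∀ y ∈ vectorSpan ℝ S, rootReflection (α i) y ∈ vectorSpan ℝ S := by
      intro i y hy
      rw [vectorSpan_def] at hy ⊢
      have h1 := Submodule.mem_map_of_mem (f := (rootReflection (α i)).toLinearEquiv.toLinearMap) hy
      rw [Submodule.map_span] at h1
      refine Submodule.span_mono ?_ h1
      rintro _ ⟨_, ⟨_, ⟨g, hg, rfl⟩, _, ⟨k, hk, rfl⟩, rfl⟩, rfl⟩
      have hi := rootReflection_mem_coxeterGroup α i
      exact ⟨_, ⟨_, mul_mem hi hg, rfl⟩, _, ⟨_, mul_mem hi hk, rfl⟩,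
        ((rootReflection (α i)).map_sub _ _).symm⟩
    have hmem : ∀ i y, y ∈ vectorSpan ℝ S → ⟪α i, y⟫_ℝ ≠ 0 → α i ∈ vectorSpan ℝ S := by
      intro i y hy hne
      have h1 := Submodule.sub_mem _ hy (hinv i y hy)
      rw [rootReflection_apply, sub_sub_cancel] at h1
      refine (Submodule.smul_mem_iff _ ?_).1 h1
      exact div_ne_zero (mul_ne_zero two_ne_zero hne)
        (inner_self_ne_zero.2 (h.linearIndependent.ne_zero i))
    have hall : ∀ (k : ℕ) (hk : k < m), α ⟨k, hk⟩ ∈ vectorSpan ℝ S := by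
      intro k
      induction k with
      | zero =>
        intro hk
        have h1 : x - rootReflection (α ⟨0, hk⟩) x ∈ vectorSpan ℝ S :=
          vsub_mem_vectorSpan ℝ ⟨1, one_mem _, rfl⟩
            ⟨_, rootReflection_mem_coxeterGroup α ⟨0, hk⟩, rfl⟩
        rw [rootReflection_apply, sub_sub_cancel] at h1
        refine (Submodule.smul_mem_iff _ ?_).1 h1
        exact div_ne_zero (mul_ne_zero two_ne_zero (h.seed_pos _ rfl).ne')
          (inner_self_ne_zero.2 (h.linearIndependent.ne_zero _))
      | succ k ih =>
        intro hk
        refine hmem _ _ (ih (by omega)) ?_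
        rw [real_inner_comm]
        exact h.inner_ne_zero _ _ rfl
    rw [Submodule.span_le]
    rintro _ ⟨i, rfl⟩
    exact hall i i.2

theorem finrank_vectorSpan_orbitPolytope (h : IsSeededPath α x) :
    Module.finrank ℝ (vectorSpan ℝ (orbitPolytope (coxeterGroup α) x)) = m := by
  rw [h.vectorSpan_orbitPolytope, finrank_span_eq_card h.linearIndependent, Fintype.card_fin]

/-- The nodes beyond the first node not in a parabolic subgroup do not contribute to the orbit of
the seed point. -/
theorem parabolic_apply_mem (h : IsSeededPath α x) {d : ℕ} (hd : d ≤ m) {J : Fin m → Prop}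
    (hJ : ∀ i : Fin m, (i : ℕ) = d → ¬ J i) {g : E ≃ₗᵢ[ℝ] E}
    (hg : g ∈ coxeterGroup fun i : {i // J i} => α i) :
    ∃ k ∈ coxeterGroup (fun i => α (Fin.castLE hd i)), g x = k x := by
  refine apply_mem_of_forall_rootReflection_mem
    (S := {y | ∃ k ∈ coxeterGroup (fun i => α (Fin.castLE hd i)), y = k x}) ?_ hg ⟨1, one_mem _, rfl⟩
  rintro ⟨i, hi⟩ _ ⟨k, hk, rfl⟩
  rcases lt_trichotomy (i : ℕ) d with hlt | heq | hgt
  · exact ⟨_, mul_mem (rootReflection_mem_coxeterGroup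
      (fun i => α (Fin.castLE hd i)) ⟨i, hlt⟩) hk, rfl⟩
  · exact absurd hi (hJ i heq)
  · refine ⟨k, hk, rootReflection_eq_self ?_⟩
    -- As node `d` is missing, `α i` is orthogonal to every root of the initial segment as well as
    -- to `x`.
    have hzero : ⟪α i, x⟫_ℝ = 0 := h.seed_eq_zero i (by omega)
    refine apply_mem_of_forall_rootReflection_mem (S := {y | ⟪α i, y⟫_ℝ = 0}) ?_ hk hzero
    intro j y hy
    rw [Set.mem_ofPred_eq] at hy ⊢
    rw [inner_rootReflection, hy, real_inner_comm (α (Fin.castLE hd j)) (α i),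
      h.inner_eq_zero (Fin.castLE hd j) i (by simp only [Fin.val_castLE]; omega)]
    simp

/-- The values of `v` beyond the node `d` are irrelevant. The case `d = m` is allowed and gives the
whole polytope. -/
theorem maximizers_eq [FiniteDimensional ℝ E] (h : IsSeededPath α x) {v : E}
    (hv : ∀ i, 0 ≤ ⟪α i, v⟫_ℝ) {d : ℕ} (hd : d ≤ m)
    (hlt : ∀ i : Fin m, (i : ℕ) < d → ⟪α i, v⟫_ℝ = 0)
    (heq : ∀ i : Fin m, (i : ℕ) = d → ⟪α i, v⟫_ℝ ≠ 0) :
    maximizers (orbitPolytope (coxeterGroup α) x) v =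
      orbitPolytope (coxeterGroup fun i => α (Fin.castLE hd i)) x := by
  have hle : ∀ y ∈ {y | ∃ g ∈ coxeterGroup α, y = g x}, ⟪v, y⟫_ℝ ≤ ⟪v, x⟫_ℝ := by
    rintro _ ⟨g, hg, rfl⟩
    exact h.inner_apply_le hv h.seed_nonneg hg
  have hmax : maximizers (orbitPolytope (coxeterGroup α) x) v =
      {y ∈ orbitPolytope (coxeterGroup α) x | ⟪v, x⟫_ℝ ≤ ⟪v, y⟫_ℝ} := by
    ext y
    refine and_congr_right fun hy => ⟨fun hy' => hy' x (self_mem_orbitPolytope _ x), ?_⟩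
    intro hy' z hz
    refine le_trans ?_ hy'
    exact convexHull_min hle (convex_halfSpace_le (innerₗ E v).isLinear _) hz
  rw [hmax, orbitPolytope, sep_le_convexHull hle, orbitPolytope]
  congr 1
  ext y
  constructor
  · rintro ⟨⟨g, hg, rfl⟩, hgx⟩
    obtain ⟨k, hk, hgk⟩ := h.exists_parabolic_apply_eq hv h.seed_nonneg hg hgx
    rw [Set.mem_ofPred_eq, hgk]
    exact h.parabolic_apply_mem hd heq hk
  · rintro ⟨g, hg, rfl⟩
    refine ⟨⟨g, coxeterGroup_comp_le α _ hg, rfl⟩, ?_⟩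
    refine apply_mem_of_forall_rootReflection_mem (S := {y | ⟪v, y⟫_ℝ = ⟪v, x⟫_ℝ}) ?_ hg rfl
    intro i y hy
    rw [Set.mem_ofPred_eq] at hy ⊢
    rw [inner_rootReflection, hy, real_inner_comm (α _) v, hlt _ i.2, mul_zero, sub_zero]

/-- The faces of the orbit polytope of a seeded path are the translates of the orbit polytopes of
its initial segments. -/
theorem faces_eq [FiniteDimensional ℝ E] (h : IsSeededPath α x) {d : ℕ} (hd : d ≤ m) :
    faces (orbitPolytope (coxeterGroup α) x) d =
      {F | ∃ g ∈ coxeterGroup α,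
        F = g '' orbitPolytope (coxeterGroup fun i => α (Fin.castLE hd i)) x} := by
  ext F
  constructor
  · rintro ⟨hne, hexp, hdim⟩
    obtain ⟨v, rfl⟩ := exists_eq_maximizers hexp hne
    obtain ⟨g, hg, hgv⟩ := exists_dominant_apply h.toIsPositiveSystem v
    -- Here `e` is the first node not orthogonal to `g v`, or `m` if there is none; comparing
    -- dimensions then forces `e = d`.
    obtain ⟨e, he, hlt, heq⟩ : ∃ e ≤ m, (∀ i : Fin m, (i : ℕ) < e → ⟪α i, g v⟫_ℝ = 0) ∧
        ∀ i : Fin m, (i : ℕ) = e → ⟪α i, g v⟫_ℝ ≠ 0 := by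
      classical
      by_cases hex : ∃ e, ∃ he : e < m, ⟪α ⟨e, he⟩, g v⟫_ℝ ≠ 0
      · obtain ⟨he, hne⟩ := Nat.find_spec hex
        refine ⟨Nat.find hex, he.le, fun i hi => ?_, fun i hi => ?_⟩
        · by_contra hne'
          exact Nat.find_min hex hi ⟨i.2, hne'⟩
        · convert hne
      · push Not at hex
        exact ⟨m, le_rfl, fun i _ => hex i i.2, fun i hi => absurd hi i.2.ne⟩
    have himage := image_maximizers g (orbitPolytope (coxeterGroup α) x) v
    rw [image_orbitPolytope hg, h.maximizers_eq hgv he hlt heq] at himage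
    have hed : e = d := by
      rw [← (h.initial he).finrank_vectorSpan_orbitPolytope, ← himage, finrank_vectorSpan_image,
        hdim]
    subst hed
    refine ⟨g⁻¹, inv_mem hg, ?_⟩
    rw [← himage, Set.image_image]
    exact ((Set.image_congr fun y _ => g.symm_apply_apply y).trans (Set.image_id _)).symm
  · rintro ⟨g, hg, rfl⟩
    obtain ⟨v, hv⟩ := exists_forall_inner_eq h.linearIndependent
      fun i => if (i : ℕ) < d then 0 else 1
    refine ⟨⟨_, Set.mem_image_of_mem g (self_mem_orbitPolytope _ x)⟩, ?_, ?_⟩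
    · rw [← h.maximizers_eq (v := v) (fun i => ?_) hd (fun i hi => ?_) fun i hi => ?_,
        image_maximizers, image_orbitPolytope hg]
      · exact isExposed_maximizers _ _
      · rw [hv]
        split_ifs <;> simp
      · rw [hv, if_pos hi]
      · rw [hv, if_neg (by omega)]
        exact one_ne_zero
    · rw [finrank_vectorSpan_image, (h.initial hd).finrank_vectorSpan_orbitPolytope]

theorem isSingleOrbit_faces [FiniteDimensional ℝ E] (h : IsSeededPath α x) {d : ℕ} (hd : d ≤ m) :
    IsSingleOrbit (coxeterGroup α) (faces (orbitPolytope (coxeterGroup α) x) d) :=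
  ⟨_, h.faces_eq hd⟩

/-- A face `g '' F₀` is the orbit polytope of the initial segment transported by `g`, so the
induction must range over all roots and seeds. -/
theorem isPlatonic [FiniteDimensional ℝ E] (h : IsSeededPath α x) :
    IsPlatonic m (orbitPolytope (coxeterGroup α) x) := by
  induction m using Nat.strong_induction_on generalizing x with
  | _ m ih =>
    -- Translation by `0` suffices even for faces away from the origin, as their generating groups
    -- are linear parabolic subgroups up to conjugation.
    refine .intro m _ (coxeterGroup α) 0 x ⟨h.finite, Set.range α, ?_⟩ (zero_vadd _ _).symm
      h.finrank_vectorSpan_orbitPolytope (fun e he => h.isSingleOrbit_faces he.le) ?_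
    · rw [coxeterGroup, ← Set.range_comp]
      rfl
    · intro e he F hF
      rw [h.faces_eq he.le] at hF
      obtain ⟨g, hg, rfl⟩ := hF
      rw [← orbitPolytope_map]
      exact ih e he ((h.initial he.le).map g)

end IsSeededPath

end SeededPath

/-! ### From simple systems to seeded paths -/

section RootSystem

theorem coxeterGroup_comp_equiv {ι κ : Type*} (α : ι → E) (f : κ ≃ ι) :
    coxeterGroup (fun j => α (f j)) = coxeterGroup α :=
  congrArg Subgroup.closure (f.surjective.range_comp fun i => rootReflection (α i))

theorem coxeterGroup_neg {ι : Type*} (α : ι → E) : coxeterGroup (fun i => -α i) = coxeterGroup α := by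
  simp only [coxeterGroup, rootReflection_neg]

variable {ι : Type*} [Fintype ι] {Φ : Set E} {α : ι → E}

theorem apply_mem_of_mem_coxeterGroup (hΦ : IsRootSystem Φ) (hα : IsSimpleSystem Φ α)
    {g : E ≃ₗᵢ[ℝ] E} (hg : g ∈ coxeterGroup α) {b : E} (hb : b ∈ Φ) : g b ∈ Φ :=
  apply_mem_of_forall_rootReflection_mem (fun i _ => hΦ.reflection_mem _ (hα.mem i) _) hg hb

/-- For finiteness: the group permutes the finite set `Φ` and fixes the orthogonal complement of the
span, so an element is determined by the images of the simple roots. -/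
theorem IsSimpleSystem.isPositiveSystem [FiniteDimensional ℝ E] (hΦ : IsRootSystem Φ)
    (hα : IsSimpleSystem Φ α) : IsPositiveSystem α where
  linearIndependent := hα.linearIndependent
  finite := by
    have := hΦ.finite.to_subtype
    refine Finite.of_injective (β := ι → Φ)
      (fun g i => ⟨g.1 (α i), apply_mem_of_mem_coxeterGroup hΦ hα g.2 (hα.mem i)⟩) ?_
    rintro ⟨g, hg⟩ ⟨k, hk⟩ hgk
    have hsimple : ∀ i, g (α i) = k (α i) := fun i => congrArg Subtype.val (congrFun hgk i)
    have hspan : ∀ y ∈ Submodule.span ℝ (Set.range α), g y = k y := by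
      intro y hy
      refine LinearMap.eqOn_span (f := g.toLinearEquiv.toLinearMap)
        (g := k.toLinearEquiv.toLinearMap) ?_ hy
      rintro _ ⟨i, rfl⟩
      exact hsimple i
    have hfix : ∀ f ∈ coxeterGroup α, ∀ z ∈ (Submodule.span ℝ (Set.range α))ᗮ, f z = z := by
      intro f hf z hz
      refine apply_mem_of_forall_rootReflection_mem (S := {z}) ?_ hf rfl
      rintro i _ rfl
      exact rootReflection_eq_self
        ((Submodule.mem_orthogonal _ _).1 hz _ (Submodule.subset_span ⟨i, rfl⟩))
    refine Subtype.ext (LinearIsometryEquiv.ext fun y => ?_)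
    obtain ⟨a, ha, b, hb, rfl⟩ :=
      Submodule.exists_add_mem_mem_orthogonal (K := Submodule.span ℝ (Set.range α)) y
    change g (a + b) = k (a + b)
    rw [map_add, map_add, hspan a ha, hfix g hg b hb, hfix k hk b hb]
  pos_or_neg g hg i := by
    obtain ⟨c, hc, hpos | hneg⟩ :=
      hα.pos_or_neg _ (apply_mem_of_mem_coxeterGroup hΦ hα hg (hα.mem i))
    · exact Or.inl ⟨c, hpos, hc⟩
    · exact Or.inr ⟨fun j => -c j, fun j => neg_nonneg.2 (hneg j), by simp [hc]⟩

theorem IsSimpleSystem.comp_equiv {κ : Type*} [Fintype κ] (hα : IsSimpleSystem Φ α) (f : κ ≃ ι) :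
    IsSimpleSystem Φ fun j => α (f j) where
  mem j := hα.mem _
  linearIndependent := hα.linearIndependent.comp _ f.injective
  pos_or_neg b hb := by
    obtain ⟨c, hc, hsign⟩ := hα.pos_or_neg b hb
    refine ⟨fun j => c (f j), ?_, hsign.imp (fun h j => h _) fun h j => h _⟩
    rw [hc, ← f.sum_comp]

theorem IsSimpleSystem.neg (hΦ : IsRootSystem Φ) (hα : IsSimpleSystem Φ α) :
    IsSimpleSystem Φ fun i => -α i where
  mem i := by
    have h := hΦ.reflection_mem _ (hα.mem i) _ (hα.mem i)
    rwa [rootReflection, Submodule.reflection_orthogonalComplement_singleton_eq_neg] at h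
  linearIndependent := hα.linearIndependent.neg
  pos_or_neg b hb := by
    obtain ⟨c, hc, hsign⟩ := hα.pos_or_neg b hb
    exact ⟨fun i => -c i, by simp [hc], hsign.symm.imp (fun h i => neg_nonneg.2 (h i))
      fun h i => neg_nonpos.2 (h i)⟩

/-- A simple system with a linear diagram and a seed point moved by the reflection of the first
node only has, up to sign, the form of a seeded path. -/
theorem exists_isSeededPath [FiniteDimensional ℝ E] (hΦ : IsRootSystem Φ)
    (hα : IsSimpleSystem Φ α) {n : ℕ} (f : Fin n ≃ ι)
    (hadj : ∀ i j : Fin n, i < j → (⟪α (f i), α (f j)⟫_ℝ ≠ 0 ↔ (i : ℕ) + 1 = j)) {x : E}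
    (hx : ∀ i : Fin n, ⟪α (f i), x⟫_ℝ ≠ 0 ↔ (i : ℕ) = 0) :
    ∃ β : Fin n → E, IsSeededPath β x ∧ coxeterGroup β = coxeterGroup α := by
  have hβ := hα.comp_equiv f
  have hne : ∀ i j : Fin n, (i : ℕ) + 1 = j → ⟪α (f i), α (f j)⟫_ℝ ≠ 0 :=
    fun i j hij => (hadj i j (Fin.lt_def.2 (by omega))).2 hij
  have hzero : ∀ i j : Fin n, (i : ℕ) + 1 < j → ⟪α (f i), α (f j)⟫_ℝ = 0 := by
    intro i j hij
    by_contra h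
    have := (hadj i j (Fin.lt_def.2 (by omega))).1 h
    omega
  have hxzero : ∀ i : Fin n, (i : ℕ) ≠ 0 → ⟪α (f i), x⟫_ℝ = 0 := by
    intro i hi
    by_contra h
    exact hi ((hx i).1 h)
  by_cases hsign : ∀ i : Fin n, (i : ℕ) = 0 → 0 < ⟪α (f i), x⟫_ℝ
  · exact ⟨fun i => α (f i),
      { hβ.isPositiveSystem hΦ with
        inner_ne_zero := hne
        inner_eq_zero := hzero
        seed_pos := hsign
        seed_eq_zero := hxzero }, coxeterGroup_comp_equiv α f⟩
  -- A seed on the negative side is handled by negating all simple roots, which preserves their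
  -- inner products and the group.
  · refine ⟨fun i => -α (f i),
      { (hβ.neg hΦ).isPositiveSystem hΦ with
        inner_ne_zero := by simpa using hne
        inner_eq_zero := by simpa using hzero
        seed_pos := ?_
        seed_eq_zero := by simpa using hxzero },
      (coxeterGroup_neg _).trans (coxeterGroup_comp_equiv α f)⟩
    push Not at hsign
    obtain ⟨j, hj, hneg⟩ := hsign
    intro i hi
    obtain rfl : i = j := Fin.ext (hi.trans hj.symm)
    rw [inner_neg_left, neg_pos]
    exact lt_of_le_of_ne hneg ((hx i).2 hi)

end RootSystem

end CoxeterPolytope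

end

theorem mainTheorem1 (n : ℕ)
    (Φ : Set (EuclideanSpace ℝ (Fin n))) (hΦ : CoxeterPolytope.IsRootSystem Φ)
    (α : Fin n → EuclideanSpace ℝ (Fin n)) (hα : CoxeterPolytope.IsSimpleSystem Φ α)
    -- the diagram is a line, with its nodes numbered along the line by `e`
    (e : CoxeterPolytope.diagram α ≃g SimpleGraph.pathGraph n)
    -- the seed decoration of the seed point `x` has exactly one square, at an extreme node `k`
    (k : Fin n) (hk : (e k : ℕ) = 0 ∨ (e k : ℕ) = n - 1)
    (x : EuclideanSpace ℝ (Fin n)) (hx : CoxeterPolytope.seedSquares α x = {k}) :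
    (∀ d < n, CoxeterPolytope.IsSingleOrbit (CoxeterPolytope.coxeterGroup α)
      (CoxeterPolytope.faces
        (CoxeterPolytope.orbitPolytope (CoxeterPolytope.coxeterGroup α) x) d)) ∧
    CoxeterPolytope.IsPlatonic n
      (CoxeterPolytope.orbitPolytope (CoxeterPolytope.coxeterGroup α) x) := by
  have hne : ∀ i, α i ≠ 0 := hα.linearIndependent.ne_zero
  have hseed : ∀ i, ⟪α i, x⟫_ℝ ≠ 0 ↔ i = k := fun i => by
    rw [← CoxeterPolytope.rootReflection_ne_self_iff (hne i)]
    exact Set.ext_iff.1 hx i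
  have hadj : ∀ i j : Fin n, i ≠ j → (⟪α (e.symm i), α (e.symm j)⟫_ℝ ≠ 0 ↔
      (i : ℕ) + 1 = j ∨ (j : ℕ) + 1 = i) := by
    intro i j hij
    have h := e.symm.map_adj_iff (v := i) (w := j)
    rw [SimpleGraph.pathGraph_adj] at h
    rw [← h]
    exact ⟨fun h' => ⟨fun h'' => hij (e.symm.injective h''), h'⟩, fun h' => h'.2⟩
  obtain ⟨β, hβ, hW⟩ : ∃ β : Fin n → EuclideanSpace ℝ (Fin n),
      CoxeterPolytope.IsSeededPath β x ∧
        CoxeterPolytope.coxeterGroup β = CoxeterPolytope.coxeterGroup α := by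
    rcases hk with hk | hk
    · refine CoxeterPolytope.exists_isSeededPath hΦ hα e.symm.toEquiv (fun i j hij => ?_)
        fun i => ?_
      · refine (hadj i j hij.ne).trans ?_
        have := Fin.lt_def.1 hij
        omega
      · refine (hseed _).trans (e.symm_apply_eq.trans ?_)
        rw [Fin.ext_iff, hk]
    -- If the square is at the far end, reverse the numbering so that it sits at node `0`.
    · refine CoxeterPolytope.exists_isSeededPath hΦ hα (Fin.revPerm.trans e.symm.toEquiv)
        (fun i j hij => ?_) fun i => ?_
      · refine (hadj i.rev j.rev (Fin.rev_injective.ne hij.ne)).trans ?_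
        have := Fin.lt_def.1 hij
        rw [Fin.val_rev, Fin.val_rev]
        omega
      · refine (hseed _).trans (e.symm_apply_eq.trans ?_)
        rw [Fin.ext_iff, hk, Fin.revPerm_apply, Fin.val_rev]
        omega
  rw [← hW]
  exact ⟨fun d hd => hβ.isSingleOrbit_faces hd.le, hβ.isPlatonic⟩
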